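/- Let $m,p,q\in\mathbb{N}$ with $m\ge q$. Let $\mathcal S\subseteq\mathbb{C}^{p+q}$ be nonempty and put $\mathcal S\ominus\mathcal S=\{u-v : u,v\in\mathcal S\}$. For a nonempty set $\mathcal U\subseteq\mathbb{C}^{n}$ and $\rho>0$, let $N_{\mathcal U}(\rho)$ be the least number of open Euclidean balls of radius $\rho$ with centers in $\mathcal U$ that cover $\mathcal U$ (with $N_{\mathcal U}(\rho)=\infty$ if no finite number suffices), let $$\underline{\dim}_{\mathrm B}(\mathcal U)=\liminf_{\rho\to0^+}\frac{\log N_{\mathcal U}(\rho)}{\log(1/\rho)},$$ and let the lower modified Minkowski dimension be $$\underline{\dim}_{\mathrm{MB}}(\mathcal U)=\inf\Big\{\sup_{i\in\mathbb N}\underline{\dim}_{\mathrm B}(\mathcal U_i) : \mathcal U\subseteq\bigcup_{i\in\mathbb N}\mathcal U_i\Big\},$$ where the infimum is over all coverings of $\mathcal U$ by sequences of nonempty compact sets $\mathcal U_i\subseteq\mathbb{C}^n$. Suppose that $\underline{\dim}_{\mathrm{MB}}(\mathcal S\ominus\mathcal S)<2m$, and let $B\in\mathbb{C}^{m\times q}$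 be a matrix of full rank. Then, for Lebesgue-almost all $A\in\mathbb{C}^{m\times p}$, the matrix $[A\ B]\in\mathbb{C}^{m\times(p+q)}$ is one-to-one on $\mathcal S$, i.e., $[A\ B]u\neq[A\ B]v$ for all distinct $u,v\in\mathcal S$. -/

import Mathlib

open Set Filter Topology MeasureTheory
open scoped ENNReal Pointwise Matrix

noncomputable section

/-- The covering number `N_U(ρ)`: the least number of open balls of radius `ρ` centred at points
of `U` that cover `U`, with value `⊤` if no finite family of such balls covers `U`. -/
def coveringNumberBall {E : Type*} [PseudoMetricSpace E] (U : Set E) (ρ : ℝ) : ℕ∞ :=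
  sInf {n : ℕ∞ | ∃ k : ℕ, n = k ∧
    ∃ u : Fin k → E, (∀ i, u i ∈ U) ∧ U ⊆ ⋃ i, Metric.ball (u i) ρ}

/-- The lower Minkowski (box-counting) dimension
`liminf_{ρ → 0+} log N_U(ρ) / log (1/ρ)`, as an extended real number. -/
def lowerMinkowskiDim {E : Type*} [PseudoMetricSpace E] (U : Set E) : EReal :=
  liminf (fun ρ : ℝ =>
    ENNReal.log (coveringNumberBall U ρ : ℝ≥0∞) / ((Real.log (1 / ρ) : ℝ) : EReal)) (𝓝[>] 0)

/-- The lower modified Minkowski dimension: the infimum, over all countable coverings of `U` by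
nonempty compact sets, of the supremum of the lower Minkowski dimensions of the covering sets. -/
def lowerModifiedMinkowskiDim {E : Type*} [PseudoMetricSpace E] (U : Set E) : EReal :=
  sInf {d : EReal | ∃ V : ℕ → Set E,
    (∀ i, (V i).Nonempty ∧ IsCompact (V i)) ∧ U ⊆ ⋃ i, V i ∧ d = ⨆ i, lowerMinkowskiDim (V i)}

end

open Set Filter Topology MeasureTheory
open scoped ENNReal Pointwise Matrix NNReal

/-! Injectivity on `S` means that the kernel of `[A B]` meets `S - S` only in 0. As `B` is
injective, a nonzero kernel vector has a nonzero coordinate in its first block, so the bad `A` form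
a countable union of the sets in `volume_fromCols_mulVec_eq_zero`. Each of these is null by
counting: for some `s < 2m` and arbitrarily small `ρ`, at most `ρ ^ (-s)` balls cover the piece.
Each ball forces every one of the `m` rows of `A` into a slab of volume `O(ρ²)`
(`exists_volume_slab_le`), so the total is `O(ρ ^ (2m - s))`. Arbitrarily small `ρ` suffice, hence
the lower dimension. -/

/-- The part of the slab `‖a ⬝ y + b‖ ≤ δ` in a box has volume `O(δ²)`, uniformly over vectors `y`
with a coordinate bounded away from zero. -/
theorem exists_volume_slab_le (p : ℕ) (R η : ℝ) (hη : 0 < η) :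
    ∃ K : ℝ≥0, ∀ (j : Fin p) (y : Fin p → ℂ) (b : ℂ) (δ : ℝ), η ≤ ‖y j‖ →
      volume {a : Fin p → ℂ | ‖a‖ ≤ R ∧ ‖a ⬝ᵥ y + b‖ ≤ δ} ≤ K * ENNReal.ofReal δ ^ 2 := by
  rcases p with _ | n
  · exact ⟨0, fun j => j.elim0⟩
  set W : ℝ≥0∞ := volume (Metric.closedBall (0 : Fin n → ℂ) R) with hW
  have hWtop : W ≠ ∞ := measure_closedBall_lt_top.ne
  refine ⟨(ENNReal.ofReal η⁻¹ ^ 2 * NNReal.pi * W).toNNReal, fun j y b δ hy => ?_⟩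
  rw [ENNReal.coe_toNNReal (by finiteness)]
  have hyj : y j ≠ 0 := fun h => by simp [h] at hy; linarith
  set D : Set (ℂ × (Fin n → ℂ)) := {z | ‖z.2‖ ≤ R ∧
    ‖z.1 * y j + (z.2 ⬝ᵥ (fun i => y (j.succAbove i)) + b)‖ ≤ δ} with hD
  have hDm : MeasurableSet D := by
    refine IsClosed.measurableSet ?_
    simp only [hD, dotProduct, ofPred_and]
    exact (isClosed_le (by fun_prop) continuous_const).inter
      (isClosed_le (by fun_prop) continuous_const)
  have hmp := volume_preserving_piFinSuccAbove (fun _ : Fin (n + 1) => ℂ) j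
  have hsub : {a : Fin (n + 1) → ℂ | ‖a‖ ≤ R ∧ ‖a ⬝ᵥ y + b‖ ≤ δ} ⊆
      (MeasurableEquiv.piFinSuccAbove (fun _ : Fin (n + 1) => ℂ) j) ⁻¹' D := by
    rintro a ⟨ha, hab⟩
    refine ⟨?_, ?_⟩
    · have hR : 0 ≤ R := (norm_nonneg a).trans ha
      exact (pi_norm_le_iff_of_nonneg hR).2 fun i => (norm_le_pi_norm a _).trans ha
    · rw [dotProduct, Fin.sum_univ_succAbove _ j] at hab
      rw [← add_assoc]
      exact hab
  refine (measure_mono hsub).trans ?_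
  rw [hmp.measure_preimage hDm.nullMeasurableSet, Measure.volume_eq_prod,
    Measure.prod_apply_symm hDm]
  -- With the other coordinates fixed, coordinate `j` is confined to a disc of radius `δ / η`.
  have hslice : ∀ w : Fin n → ℂ, volume ((fun x : ℂ => (x, w)) ⁻¹' D) ≤
      (Metric.closedBall (0 : Fin n → ℂ) R).indicator
        (fun _ => ENNReal.ofReal η⁻¹ ^ 2 * NNReal.pi * ENNReal.ofReal δ ^ 2) w := by
    intro w
    by_cases hw : w ∈ Metric.closedBall (0 : Fin n → ℂ) R
    · rw [indicator_of_mem hw]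
      set e : ℂ := w ⬝ᵥ (fun i => y (j.succAbove i)) + b
      have hball : (fun x : ℂ => (x, w)) ⁻¹' D ⊆ Metric.closedBall (-e / y j) (η⁻¹ * δ) := by
        rintro x ⟨-, hx⟩
        change ‖x * y j + e‖ ≤ δ at hx
        rw [mem_closedBall_iff_norm]
        have h1 : x - -e / y j = (x * y j + e) / y j := by field_simp; ring
        rw [h1, norm_div, div_eq_mul_inv, mul_comm]
        gcongr
      refine (measure_mono hball).trans ?_
      rw [Complex.volume_closedBall, ENNReal.ofReal_mul (by positivity), mul_pow]
      exact le_of_eq (by ring)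
    · rw [indicator_of_notMem hw, nonpos_iff_eq_zero]
      have : (fun x : ℂ => (x, w)) ⁻¹' D = ∅ := by
        ext x
        simp only [mem_closedBall_zero_iff] at hw
        simp [hD, hw]
      rw [this, measure_empty]
  refine (lintegral_mono hslice).trans ?_
  rw [lintegral_indicator Metric.isClosed_closedBall.measurableSet, setLIntegral_const]
  exact le_of_eq (by rw [hW]; ring)

/-- A finite covering number is attained. -/
theorem exists_cover_of_coveringNumberBall_lt_top {E : Type*} [PseudoMetricSpace E] {U : Set E}
    {ρ : ℝ} (h : coveringNumberBall U ρ < ⊤) :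
    ∃ k : ℕ, coveringNumberBall U ρ = k ∧
      ∃ u : Fin k → E, (∀ i, u i ∈ U) ∧ U ⊆ ⋃ i, Metric.ball (u i) ρ := by
  have hne : {n : ℕ∞ | ∃ k : ℕ, n = k ∧
      ∃ u : Fin k → E, (∀ i, u i ∈ U) ∧ U ⊆ ⋃ i, Metric.ball (u i) ρ}.Nonempty := by
    by_contra hcon
    rw [coveringNumberBall, not_nonempty_iff_eq_empty.1 hcon, sInf_empty] at h
    exact lt_irrefl _ h
  exact csInf_mem hne

/-- A set of lower Minkowski dimension less than `s` admits, for arbitrarily small radii `ρ`, a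
cover by at most `ρ ^ (-s)` balls of radius `ρ`. -/
theorem frequently_cover_of_lowerMinkowskiDim_lt {E : Type*} [PseudoMetricSpace E] {U : Set E}
    {s : ℝ} (h : lowerMinkowskiDim U < s) :
    ∃ᶠ ρ : ℝ in 𝓝[>] 0, ∃ k : ℕ, (k : ℝ≥0∞) ≤ ENNReal.ofReal (ρ ^ (-s)) ∧
      ∃ u : Fin k → E, (∀ i, u i ∈ U) ∧ U ⊆ ⋃ i, Metric.ball (u i) ρ := by
  have hev : ∀ᶠ ρ : ℝ in 𝓝[>] 0, ρ ∈ Ioo (0 : ℝ) 1 := Ioo_mem_nhdsGT one_pos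
  refine ((frequently_lt_of_liminf_lt (by isBoundedDefault) h).and_eventually hev).mono ?_
  rintro ρ ⟨hlt, hρ0, hρ1⟩
  have hlog : 0 < Real.log (1 / ρ) := Real.log_pos (by rw [lt_div_iff₀ hρ0]; linarith)
  rw [EReal.div_lt_iff (by exact_mod_cast hlog) (EReal.coe_ne_top _)] at hlt
  have hexp : (s : EReal) * (Real.log (1 / ρ) : ℝ) = ENNReal.log (ENNReal.ofReal (ρ ^ (-s))) := by
    rw [ENNReal.log_ofReal_of_pos (by positivity), Real.log_rpow hρ0, one_div, Real.log_inv,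
      ← EReal.coe_mul]
    congr 1
    ring
  rw [hexp, ENNReal.log_lt_log_iff] at hlt
  have hfin : coveringNumberBall U ρ < ⊤ := by
    refine lt_top_iff_ne_top.2 fun htop => ?_
    rw [htop] at hlt
    simp at hlt
  obtain ⟨k, hk, hu⟩ := exists_cover_of_coveringNumberBall_lt_top hfin
  refine ⟨k, ?_, hu⟩
  rw [hk] at hlt
  simpa using hlt.le

/-- The bounded matrices `A` for which `[A B]` kills a vector of `U` whose `j`-th coordinate is
bounded away from zero form a null set, when the lower Minkowski dimension of `U` is less than
the real dimension of the target. -/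
theorem volume_fromCols_mulVec_eq_zero {m p q : ℕ} {U : Set (EuclideanSpace ℂ (Fin p ⊕ Fin q))}
    (hU : lowerMinkowskiDim U < ((2 * m : ℕ) : EReal)) (B : Matrix (Fin m) (Fin q) ℂ)
    (R : ℝ) {η : ℝ} (hη : 0 < η) (j : Fin p) :
    volume {A : Fin m → Fin p → ℂ | ‖A‖ ≤ R ∧ ∃ x ∈ U, η ≤ ‖x (Sum.inl j)‖ ∧
      Matrix.fromCols (Matrix.of A) B *ᵥ x.ofLp = 0} = 0 := by
  set T := {A : Fin m → Fin p → ℂ | ‖A‖ ≤ R ∧ ∃ x ∈ U, η ≤ ‖x (Sum.inl j)‖ ∧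
      Matrix.fromCols (Matrix.of A) B *ᵥ x.ofLp = 0} with hT
  rcases lt_or_ge R 0 with hR | hR
  · have : T = ∅ := eq_empty_of_forall_notMem fun A hA => by
      linarith [hA.1, norm_nonneg A]
    rw [this, measure_empty]
  obtain ⟨s, hUs, hsm⟩ := EReal.lt_iff_exists_real_btwn.1 hU
  have hsm' : s < 2 * m := by
    rw [← EReal.coe_natCast, EReal.coe_lt_coe_iff] at hsm
    exact_mod_cast hsm
  -- A ball centre within `ρ < η / 2` of `x` keeps its `j`-th coordinate above `η / 2`.
  obtain ⟨K, hK⟩ := exists_volume_slab_le p R (η / 2) (by positivity)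
  -- Bounds the `ℓ¹` norm of every row of `[A B]` when `‖A‖ ≤ R`.
  set C : ℝ := p * R + ∑ r, ∑ l, ‖B r l‖ with hC
  have hC0 : 0 ≤ C := by positivity
  set f : ℝ → ℝ≥0∞ := fun ρ => ENNReal.ofReal (ρ ^ (2 * m - s)) *
    (K * ENNReal.ofReal C ^ 2) ^ m with hf
  have hf0 : Tendsto f (𝓝[>] 0) (𝓝 0) := by
    have h1 : Tendsto (fun ρ : ℝ => ENNReal.ofReal (ρ ^ (2 * m - s))) (𝓝[>] 0) (𝓝 0) := by
      have h2 : Tendsto (fun ρ : ℝ => ρ ^ (2 * m - s)) (𝓝[>] 0) (𝓝 0) := by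
        have := (Real.continuousAt_rpow_const 0 (2 * m - s) (Or.inr (by linarith))).tendsto
        rw [Real.zero_rpow (by linarith)] at this
        exact this.mono_left nhdsWithin_le_nhds
      simpa using ENNReal.tendsto_ofReal h2
    simpa [hf] using ENNReal.Tendsto.mul_const (b := (K * ENNReal.ofReal C ^ 2) ^ m) h1
      (Or.inr (by finiteness))
  have hev : ∀ᶠ ρ : ℝ in 𝓝[>] 0, ρ ∈ Ioo (0 : ℝ) (η / 2) := Ioo_mem_nhdsGT (by positivity)
  have hfreq : ∃ᶠ ρ : ℝ in 𝓝[>] 0, volume T ≤ f ρ := by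
    refine ((frequently_cover_of_lowerMinkowskiDim_lt hUs).and_eventually hev).mono ?_
    rintro ρ ⟨⟨k, hk, u, -, hcov⟩, hρ0, hρη⟩
    -- Including the condition on the centre makes `P i r` empty for irrelevant balls, so the slab
    -- bound holds for all `i`.
    set P : Fin k → Fin m → Set (Fin p → ℂ) := fun i r =>
      {a | η / 2 ≤ ‖u i (Sum.inl j)‖ ∧ ‖a‖ ≤ R ∧
        ‖a ⬝ᵥ (fun t => u i (Sum.inl t)) + B r ⬝ᵥ (fun l => u i (Sum.inr l))‖ ≤ C * ρ} with hP
    have hPvol : ∀ i r, volume (P i r) ≤ K * ENNReal.ofReal (C * ρ) ^ 2 := by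
      intro i r
      by_cases h : η / 2 ≤ ‖u i (Sum.inl j)‖
      · exact (measure_mono fun a ha => ha.2).trans
          (hK j (fun t => u i (Sum.inl t)) (B r ⬝ᵥ (fun l => u i (Sum.inr l))) (C * ρ) h)
      · have : P i r = ∅ := eq_empty_of_forall_notMem fun a ha => h ha.1
        simp [this]
    have hsub : T ⊆ ⋃ i, Set.univ.pi (P i) := by
      rintro A ⟨hA, x, hx, hxj, hAx⟩
      obtain ⟨i, hi⟩ := mem_iUnion.1 (hcov hx)
      have hd : ∀ t, ‖u i t - x t‖ ≤ ρ := by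
        intro t
        have h1 := PiLp.norm_apply_le (u i - x) t
        have h2 : ‖u i - x‖ < ρ := by rwa [← dist_eq_norm, dist_comm]
        exact (h1.trans h2.le)
      refine mem_iUnion.2 ⟨i, fun r _ => ⟨?_, (norm_le_pi_norm A r).trans hA, ?_⟩⟩
      · have := norm_sub_norm_le (x (Sum.inl j)) (u i (Sum.inl j))
        rw [norm_sub_rev] at this
        linarith [hd (Sum.inl j)]
      · have hrow : A r ⬝ᵥ (fun t => x (Sum.inl t)) + B r ⬝ᵥ (fun l => x (Sum.inr l)) = 0 := by
          have := congrFun hAx r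
          rw [Matrix.fromCols_mulVec] at this
          exact this
        have hdiff : A r ⬝ᵥ (fun t => u i (Sum.inl t)) + B r ⬝ᵥ (fun l => u i (Sum.inr l)) =
            ∑ t, A r t * (u i (Sum.inl t) - x (Sum.inl t)) +
            ∑ l, B r l * (u i (Sum.inr l) - x (Sum.inr l)) := by
          rw [← sub_zero (A r ⬝ᵥ _ + _), ← hrow]
          simp only [dotProduct, mul_sub, Finset.sum_sub_distrib]
          ring
        rw [hdiff]
        have hA' : ‖∑ t, A r t * (u i (Sum.inl t) - x (Sum.inl t))‖ ≤ p * R * ρ := by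
          refine (norm_sum_le_of_le (f := fun t => A r t * (u i (Sum.inl t) - x (Sum.inl t)))
            Finset.univ (n := fun _ => R * ρ) fun t _ => ?_).trans ?_
          · rw [norm_mul]
            exact mul_le_mul (((norm_le_pi_norm (A r) t).trans (norm_le_pi_norm A r)).trans hA)
              (hd _) (norm_nonneg _) hR
          · simp [mul_assoc]
        have hB' : ‖∑ l, B r l * (u i (Sum.inr l) - x (Sum.inr l))‖ ≤
            (∑ r, ∑ l, ‖B r l‖) * ρ := by
          refine (norm_sum_le_of_le (f := fun l => B r l * (u i (Sum.inr l) - x (Sum.inr l)))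
            Finset.univ (n := fun l => ‖B r l‖ * ρ) fun l _ => ?_).trans ?_
          · rw [norm_mul]
            exact mul_le_mul_of_nonneg_left (hd _) (norm_nonneg _)
          · rw [← Finset.sum_mul]
            gcongr
            exact Finset.single_le_sum (f := fun r => ∑ l, ‖B r l‖)
              (fun _ _ => by positivity) (Finset.mem_univ r)
        calc _ ≤ p * R * ρ + (∑ r, ∑ l, ‖B r l‖) * ρ := (norm_add_le _ _).trans (add_le_add hA' hB')
          _ = C * ρ := by rw [hC]; ring
    calc volume T ≤ ∑ i, volume (Set.univ.pi (P i)) :=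
          (measure_mono hsub).trans (measure_iUnion_fintype_le _ _)
      _ ≤ ∑ _i : Fin k, (K * ENNReal.ofReal (C * ρ) ^ 2) ^ m := by
          refine Finset.sum_le_sum fun i _ => ?_
          rw [volume_pi, Measure.pi_pi]
          refine (Finset.prod_le_prod' fun r _ => hPvol i r).trans ?_
          simp
      _ = k * (K * ENNReal.ofReal (C * ρ) ^ 2) ^ m := by simp
      _ ≤ ENNReal.ofReal (ρ ^ (-s)) * (K * ENNReal.ofReal (C * ρ) ^ 2) ^ m := by gcongr
      _ = f ρ := by
          have h1 : ENNReal.ofReal (ρ ^ (2 * m - s)) =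
              ENNReal.ofReal (ρ ^ (-s)) * (ENNReal.ofReal ρ ^ 2) ^ m := by
            rw [← pow_mul, ← ENNReal.ofReal_pow hρ0.le, ← ENNReal.ofReal_mul (by positivity),
              ← Real.rpow_natCast, ← Real.rpow_add hρ0]
            congr 2
            push_cast
            ring
          simp only [hf]
          rw [h1, ENNReal.ofReal_mul hC0, mul_assoc, ← mul_pow]
          ring
  by_contra hne
  obtain ⟨ρ, h1, h2⟩ := (hfreq.and_eventually
    (hf0.eventually_lt_const (pos_iff_ne_zero.2 hne))).exists
  exact absurd h2 (not_lt.2 h1)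

theorem mainTheorem2 (m p q : ℕ) (hqm : q ≤ m)
    (S : Set (EuclideanSpace ℂ (Fin p ⊕ Fin q))) (hS : S.Nonempty)
    (hdim : lowerModifiedMinkowskiDim (S - S) < ((2 * m : ℕ) : EReal))
    (B : Matrix (Fin m) (Fin q) ℂ) (hB : B.rank = min m q) :
    ∀ᵐ A : Fin m → Fin p → ℂ,
      Set.InjOn (fun x : EuclideanSpace ℂ (Fin p ⊕ Fin q) =>
        Matrix.fromCols (Matrix.of A) B *ᵥ x.ofLp) S := by
  have hinj : Function.Injective B.mulVec := by
    rw [Matrix.mulVec_injective_iff, linearIndependent_iff_card_eq_finrank_span, Set.finrank,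
      ← Matrix.rank_eq_finrank_span_cols, hB, Fintype.card_fin, min_eq_right hqm]
  obtain ⟨_, ⟨V, -, hcov, rfl⟩, hV⟩ := sInf_lt_iff.1 hdim
  -- One index `n` both bounds `‖A‖` and keeps the coordinate away from zero.
  have hnull : ∀ᵐ A : Fin m → Fin p → ℂ, ∀ (i n : ℕ) (j : Fin p),
      ¬ (‖A‖ ≤ n ∧ ∃ x ∈ V i, (1 / (n + 1) : ℝ) ≤ ‖x (Sum.inl j)‖ ∧
        Matrix.fromCols (Matrix.of A) B *ᵥ x.ofLp = 0) := by
    refine ae_all_iff.2 fun i => ae_all_iff.2 fun n => ae_all_iff.2 fun j => ?_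
    rw [ae_iff]
    simp only [not_not]
    exact volume_fromCols_mulVec_eq_zero ((le_iSup _ i).trans_lt hV) B n
      Nat.one_div_pos_of_nat j
  filter_upwards [hnull] with A hA u hu v hv huv
  by_contra hne
  obtain ⟨i, hi⟩ := mem_iUnion.1 (hcov (sub_mem_sub hu hv))
  have hker : Matrix.fromCols (Matrix.of A) B *ᵥ (u - v).ofLp = 0 := by
    rw [WithLp.ofLp_sub, Matrix.mulVec_sub, sub_eq_zero]
    exact huv
  by_cases hy : ∃ j : Fin p, (u - v) (Sum.inl j) ≠ 0
  · obtain ⟨j, hj⟩ := hy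
    obtain ⟨n₁, hn₁⟩ := exists_nat_one_div_lt (norm_pos_iff.2 hj)
    obtain ⟨n₂, hn₂⟩ := exists_nat_ge ‖A‖
    refine hA i (max n₁ n₂) j ⟨hn₂.trans (by simp), u - v, hi, ?_, hker⟩
    refine le_trans ?_ hn₁.le
    exact Nat.one_div_le_one_div (le_max_left _ _)
  -- The first block vanishes, so `B` kills the second.
  · push Not at hy
    have hz : B *ᵥ ((u - v).ofLp ∘ Sum.inr) = B *ᵥ 0 := by
      have h0 : (u - v).ofLp ∘ Sum.inl = 0 := funext hy
      rw [Matrix.fromCols_mulVec, h0, Matrix.mulVec_zero, zero_add] at hker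
      rw [hker, Matrix.mulVec_zero]
    have hz0 := hinj hz
    refine hne (sub_eq_zero.1 ?_)
    ext t
    rcases t with t | t
    · exact hy t
    · exact congrFun hz0 t
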